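/- A $2$-colored partition of an integer $m\ge 0$ is a partition of $m$ in which each part is assigned one of two colors, where the order of the colored parts is irrelevant (that is, a finite multiset of pairs consisting of a positive integer and one of two colors, in which the integers sum to $m$). Let $p_{-2}(m)$ denote the number of $2$-colored partitions of $m$; equivalently, $\sum_{m\ge 0}p_{-2}(m)q^m=\prod_{i\ge 1}(1-q^i)^{-2}$. For all integers $n\ge 0$ and $\alpha\ge 1$, the numbers $\frac{7\cdot 5^{2\alpha-1}+1}{12}$ and $\frac{11\cdot 5^{2\alpha}+1}{12}$ are integers, and $$p_{-2}\left(5^{2\alpha-1}n+\frac{7\cdot 5^{2\alpha-1}+1}{12}\right)\equiv 0 \pmod{5^{\alpha}},$$ $$p_{-2}\left(5^{2\alpha}n+\frac{11\cdot 5^{2\alpha}+1}{12}\right)\equiv 0 \pmod{5^{\alpha+1}}.$$ -/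

import Mathlib

/-- A `k`-colored partition of `n`: a finite multiset of positive parts, each part carrying one of
`k` colors (so the element `(a, c)` is a part of size `a` and color `c`), whose sizes sum to `n`. -/
@[ext]
structure ColoredPartition (k n : ℕ) where
  parts : Multiset (ℕ × Fin k)
  parts_pos : ∀ x ∈ parts, 0 < x.1
  parts_sum : (parts.map Prod.fst).sum = n

/-- There are finitely many `k`-colored partitions of `n`, so that counting them is meaningful. -/
instance ColoredPartition.finite (k n : ℕ) : Finite (ColoredPartition k n) := by
  classical
  let B : Multiset (ℕ × Fin k) := n • (Finset.range (n + 1) ×ˢ (Finset.univ : Finset (Fin k))).val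
  have key : ∀ p : ColoredPartition k n, p.parts ≤ B := by
    intro p
    rw [Multiset.le_iff_count]
    intro x
    by_cases hx : x ∈ p.parts
    · have hpos := p.parts_pos x hx
      have hle : x.1 ≤ n := by
        rw [← p.parts_sum]
        exact Multiset.le_sum_of_mem (Multiset.mem_map_of_mem Prod.fst hx)
      have hcard : p.parts.card ≤ n := by
        have h : (p.parts.map Prod.fst).card • 1 ≤ (p.parts.map Prod.fst).sum := by
          apply Multiset.card_nsmul_le_sum
          intro a ha
          obtain ⟨y, hy, rfl⟩ := Multiset.mem_map.1 ha
          exact p.parts_pos y hy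
        rw [p.parts_sum] at h
        simpa using h
      have hmem : x ∈ Finset.range (n + 1) ×ˢ (Finset.univ : Finset (Fin k)) := by
        simp only [Finset.mem_product, Finset.mem_range, Finset.mem_univ, and_true]
        omega
      have hB : Multiset.count x B = n := by
        simp only [B, Multiset.count_nsmul]
        rw [Multiset.count_eq_one_of_mem (Finset.nodup _) hmem, mul_one]
      rw [hB]
      exact (Multiset.count_le_card x p.parts).trans hcard
    · rw [Multiset.count_eq_zero_of_notMem hx]
      exact Nat.zero_le _
  refine Finite.of_injective (β := Set.Iic B) (fun p => ⟨p.parts, key p⟩) ?_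
  intro p q h
  exact ColoredPartition.ext (congrArg Subtype.val h)

/-- `coloredPartitionCount k n` is the number `p_{-k}(n)` of `k`-colored partitions of `n`. -/
noncomputable def coloredPartitionCount (k n : ℕ) : ℕ :=
  Nat.card (ColoredPartition k n)

/-!
The argument is the classical one of Ramanujan and Watson, carried out with formal power series over
`ℤ`. Let `f = ∏ (1 - Xⁿ)` be Euler's product, which is `pentagonalSeries ℤ` by the pentagonal number
theorem. Two-coloured partitions are pairs of partitions, so their generating function is `1 / f²`.
Let `U` be the operator `∑ aₙ Xⁿ ↦ ∑ a₅ₙ Xⁿ` (`sect 0`), which satisfies `U (g(X⁵) h) = g U h`.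

*The modular equation.* Pentagonal numbers are `0`, `1` or `2` modulo `5`, so
`f = A - X D + X² C` with `A`, `C`, `D` series in `X⁵`, and `D = f(X²⁵)`. The cube of `f` has only
triangular exponents (Jacobi; obtained here from a finite identity for Gaussian binomials), none of
which is `2` modulo `5`; the vanishing of that component of `f³` says `A C = -D²`. Multiplying the
conjugates `f(ωX)` over the fifth roots of unity `ω`, once through the product and once through the
dissection, gives `D (A⁵ - 11 X⁵ D⁵ + X¹⁰ C⁵) = f(X⁵)⁶`. Together these show that
`u = X f(X²⁵) / f` and `w = X f(X⁵)⁶ / f⁶` satisfy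
`u⁵ = w(X⁵) (25 u⁴ + 25 u³ + 15 u² + 5 u + 1)` (`uSeries_pow_five`).

*The recurrence.* Hence `U (uⁱ)` is a polynomial in `w`, given by a five-term recurrence
(`sect_zero_uSeries_pow`), and by induction its coefficient of `wʲ` is divisible by
`5 ^ ⌊(5 j - i - 1) / 2⌋` (`five_pow_dvd_coeff_sectPoly`). Since `w(X⁵) w = u⁶`, the series
`U (uʳ wⁱ)` are polynomials in `w` as well, with coefficients taken from the `U (uʲ)`.

*The iteration.* The generating functions of `p₋₂` on the progressions of the theorem, multiplied by
`f(X⁵)²` in the odd case and by `f²` in the even case, arise from `1` by applying in turn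
`g ↦ U (u² g)` and `g ↦ U g`. They lie in the groups `divSpan k` of polynomials in `w` whose
coefficient of `w ^ (j + 1)` is divisible by `5 ^ (k + ⌊5 j / 2⌋)`; the first map preserves `k` and
the second raises it by one (`sect_zero_uSeries_pow_mul_mem_divSpan`). As `f` is invertible, the
divisibility passes to the numbers `p₋₂` themselves.
-/

open PowerSeries

/-! ### The generating function of two-coloured partitions -/

/-- A two-coloured partition of `n` is the same as an ordered pair of partitions (the parts of the
first colour and the parts of the second colour) whose sizes add up to `n`. -/
noncomputable def ColoredPartition.equivPair (n : ℕ) :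
    ColoredPartition 2 n ≃
      (Σ x : Finset.HasAntidiagonal.antidiagonal n, Nat.Partition x.1.1 × Nat.Partition x.1.2) where
  toFun p := ⟨⟨(((p.parts.filter (·.2 = 0)).map Prod.fst).sum,
      ((p.parts.filter (¬ ·.2 = 0)).map Prod.fst).sum), by
        rw [Finset.HasAntidiagonal.mem_antidiagonal, ← Multiset.sum_add, ← Multiset.map_add,
          Multiset.filter_add_not, p.parts_sum]⟩,
    ⟨(p.parts.filter (·.2 = 0)).map Prod.fst, by
      intro i hi
      obtain ⟨x, hx, rfl⟩ := Multiset.mem_map.1 hi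
      exact p.parts_pos x (Multiset.mem_of_mem_filter hx), rfl⟩,
    ⟨(p.parts.filter (¬ ·.2 = 0)).map Prod.fst, by
      intro i hi
      obtain ⟨x, hx, rfl⟩ := Multiset.mem_map.1 hi
      exact p.parts_pos x (Multiset.mem_of_mem_filter hx), rfl⟩⟩
  invFun y := ⟨y.2.1.parts.map (·, 0) + y.2.2.parts.map (·, 1), by
      intro x hx
      rcases Multiset.mem_add.1 hx with h | h
      · obtain ⟨i, hi, rfl⟩ := Multiset.mem_map.1 h
        exact y.2.1.parts_pos hi
      · obtain ⟨i, hi, rfl⟩ := Multiset.mem_map.1 h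
        exact y.2.2.parts_pos hi, by
      simp only [Multiset.map_add, Multiset.map_map, Function.comp_def, Multiset.map_id',
        Multiset.sum_add, Nat.Partition.parts_sum]
      exact Finset.HasAntidiagonal.mem_antidiagonal.1 y.1.2⟩
  left_inv p := by
    ext1
    simp only [Multiset.map_map, Function.comp_def]
    conv_rhs => rw [← Multiset.filter_add_not (·.2 = 0) p.parts]
    congr 1
    · conv_rhs => rw [← Multiset.map_id (Multiset.filter _ _)]
      refine Multiset.map_congr rfl fun x hx => ?_
      exact Prod.ext rfl (Multiset.of_mem_filter hx).symm
    · conv_rhs => rw [← Multiset.map_id (Multiset.filter _ _)]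
      refine Multiset.map_congr rfl fun x hx => ?_
      have := Multiset.of_mem_filter hx
      refine Prod.ext rfl ?_
      show (1 : Fin 2) = x.2
      generalize x.2 = c at *
      fin_cases c <;> simp_all
  right_inv y := by
    obtain ⟨⟨⟨i, j⟩, h⟩, ⟨s, hs, hs'⟩, ⟨t, ht, ht'⟩⟩ := y
    change s.sum = i at hs'
    change t.sum = j at ht'
    subst hs' ht'
    have h0 : ((s.map (·, (0 : Fin 2)) + t.map (·, (1 : Fin 2))).filter (·.2 = 0)).map Prod.fst
        = s := by
      simp [Multiset.filter_add, Multiset.filter_map]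
    have h1 : ((s.map (·, (0 : Fin 2)) + t.map (·, (1 : Fin 2))).filter (¬ ·.2 = 0)).map Prod.fst
        = t := by
      simp [Multiset.filter_add, Multiset.filter_map]
    simp only
    congr!

/-- The generating function `∑ p(n) Xⁿ` of the partition function. -/
noncomputable def partitionSeries : ℤ⟦X⟧ :=
  PowerSeries.mk fun n => (Fintype.card (Nat.Partition n) : ℤ)

theorem coloredPartitionCount_two (n : ℕ) :
    (coloredPartitionCount 2 n : ℤ) = coeff n (partitionSeries ^ 2) := by
  rw [coloredPartitionCount, Nat.card_congr (ColoredPartition.equivPair n),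
    Nat.card_eq_fintype_card, Fintype.card_sigma, pow_two, coeff_mul]
  simp only [partitionSeries, coeff_mk, Fintype.card_prod]
  push_cast
  exact Finset.sum_coe_sort (Finset.HasAntidiagonal.antidiagonal n) fun x =>
    (Fintype.card x.1.Partition : ℤ) * Fintype.card x.2.Partition

open scoped PowerSeries.WithPiTopology in
/-- Euler's generating function for partitions. -/
theorem partitionSeries_mul_pentagonalSeries : partitionSeries * pentagonalSeries ℤ = 1 := by
  let : TopologicalSpace ℤ := ⊥
  have : DiscreteTopology ℤ := ⟨rfl⟩
  have h1 := Nat.Partition.hasProd_powerSeriesMk_card_restricted ℤ (fun _ => True)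
  have h2 := h1.mul (WithPiTopology.hasProd_one_sub_X_pow ℤ)
  have h3 : (PowerSeries.mk fun n => ((Nat.Partition.restricted n (fun _ => True)).card : ℤ))
      = partitionSeries := by
    ext n
    simp [partitionSeries, Nat.Partition.restricted]
  rw [h3] at h2
  have h4 : ∀ i : ℕ, (if True then ∑' j : ℕ, (X : ℤ⟦X⟧) ^ ((i + 1) * j) else 1)
      * (1 - X ^ (i + 1)) = 1 := by
    intro i
    simp only [if_true, pow_mul]
    exact WithPiTopology.tsum_pow_mul_one_sub_of_constantCoeff_eq_zero (by simp)
  simp only [h4] at h2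
  exact h2.unique hasProd_one

/-! ### Sections of power series modulo five -/

/-- The `r`-th section `∑ f(5n + r) Xⁿ` of a power series, for the modulus `5`. -/
noncomputable def sect {R : Type*} [CommRing R] (r : ℕ) : R⟦X⟧ →ₗ[R] R⟦X⟧ where
  toFun f := PowerSeries.mk fun n => coeff (5 * n + r) f
  map_add' f g := by ext; simp
  map_smul' c f := by ext; simp

/-- The substitution `X ↦ X ^ 5`. -/
noncomputable abbrev expandFive {R : Type*} [CommRing R] : R⟦X⟧ →ₐ[R] R⟦X⟧ :=
  PowerSeries.expand 5 (by norm_num)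

section
variable {R : Type*} [CommRing R]

@[simp] theorem coeff_sect (r n : ℕ) (f : R⟦X⟧) : coeff n (sect r f) = coeff (5 * n + r) f := by
  simp [sect]

/-- Sections are linear over the power series in `X⁵`. -/
theorem sect_expandFive_mul_of_lt {r : ℕ} (hr : r < 5) (f g : R⟦X⟧) :
    sect r (expandFive f * g) = f * sect r g := by
  ext n
  simp only [coeff_sect, coeff_mul]
  refine (Finset.sum_of_injOn (fun x => (5 * x.1, 5 * x.2 + r)) ?_ ?_ ?_ ?_).symm
  · rintro ⟨a, b⟩ - ⟨c, d⟩ - h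
    simp only [Prod.mk.injEq] at h ⊢
    omega
  · rintro ⟨a, b⟩ h
    simp only [Finset.mem_coe, Finset.HasAntidiagonal.mem_antidiagonal] at h ⊢
    omega
  · rintro ⟨a, b⟩ h h'
    rw [Finset.HasAntidiagonal.mem_antidiagonal] at h
    dsimp only at h
    have : ¬ 5 ∣ a := by
      rintro ⟨c, rfl⟩
      refine h' ⟨(c, n - c), ?_, ?_⟩
      · simp only [Finset.mem_coe, Finset.HasAntidiagonal.mem_antidiagonal] at h ⊢
        omega
      · refine Prod.ext rfl ?_
        change 5 * (n - c) + r = b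
        omega
    simp [coeff_expand_of_not_dvd _ _ _ this]
  · rintro ⟨a, b⟩ -
    simp [coeff_expand_mul]

theorem sect_X_pow {r : ℕ} (hr : r < 5) (k : ℕ) :
    sect r (X ^ k : R⟦X⟧) = if k % 5 = r then X ^ (k / 5) else 0 := by
  ext n
  rw [coeff_sect, coeff_X_pow]
  split_ifs with h1 h2 h3
  · rw [coeff_X_pow, if_pos (by omega)]
  · omega
  · rw [coeff_X_pow, if_neg (by omega)]
  · simp

theorem sect_expandFive_mul_X_pow {r : ℕ} (hr : r < 5) (f : R⟦X⟧) (k : ℕ) :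
    sect r (expandFive f * X ^ k) = if k % 5 = r then f * X ^ (k / 5) else 0 := by
  rw [sect_expandFive_mul_of_lt hr, sect_X_pow hr, mul_ite, mul_zero]

/-- A power series is the sum of its five sections. -/
theorem eq_sum_sect (f : R⟦X⟧) :
    f = ∑ r ∈ Finset.range 5, expandFive (sect r f) * X ^ r := by
  ext n
  rw [map_sum, Finset.sum_eq_single (n % 5)]
  · rw [coeff_mul_X_pow', if_pos (Nat.mod_le _ _), coeff_expand, if_pos (by omega), coeff_sect]
    congr 2
    omega
  · intro r hr hrn
    rw [Finset.mem_range] at hr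
    rw [coeff_mul_X_pow']
    split_ifs with h
    · exact coeff_expand_of_not_dvd _ _ _ (by omega)
    · rfl
  · intro h
    exact absurd (Finset.mem_range.2 (Nat.mod_lt n (by norm_num))) h
end

/-! ### The five-dissection of Euler's product -/

section
variable (R : Type*) [CommRing R]

theorem constantCoeff_pentagonalSeries : constantCoeff (pentagonalSeries R) = 1 := by
  rw [← coeff_zero_eq_constantCoeff_apply]
  simpa [pentagonal] using coeff_pentagonalSeries_pentagonal R 0

/-- No generalized pentagonal number is congruent to `3` or `4` modulo `5`. -/
theorem pentagonal_mod_five (k : ℤ) :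
    pentagonal k % 5 = 0 ∨ pentagonal k % 5 = 1 ∨ pentagonal k % 5 = 2 := by
  have h := two_mul_natCast_pentagonal k
  generalize pentagonal k = N at *
  obtain ⟨m, hm⟩ : ∃ m, k = 5 * m ∨ k = 5 * m + 1 ∨ k = 5 * m + 2 ∨ k = 5 * m + 3 ∨
      k = 5 * m + 4 := ⟨k / 5, by omega⟩
  rcases hm with rfl | rfl | rfl | rfl | rfl <;> ring_nf at h <;> omega

theorem sect_pentagonalSeries_eq_zero {r : ℕ} (h : 2 < r) (hr : r < 5) :
    sect r (pentagonalSeries R) = 0 := by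
  ext n
  rw [coeff_sect]
  refine coeff_pentagonalSeries_eq_zero R ?_
  rintro ⟨k, hk⟩
  have := pentagonal_mod_five k
  omega

/-- The pentagonal numbers `aₖ` congruent to `1` modulo `5` are those of index `5k + 1`, and
`a_{5k+1} = 25 a_{-k} + 1`. -/
theorem sect_one_pentagonalSeries :
    sect 1 (pentagonalSeries R) = - expandFive (pentagonalSeries R) := by
  have key : ∀ k : ℤ, pentagonal (5 * k + 1) = 5 * (5 * pentagonal (-k)) + 1 := by
    intro k
    have h1 := two_mul_natCast_pentagonal (5 * k + 1)
    have h2 := two_mul_natCast_pentagonal_neg k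
    have : 2 * (pentagonal (5 * k + 1) : ℤ) = 2 * (5 * (5 * pentagonal (-k)) + 1) := by
      linear_combination h1 - 25 * h2
    omega
  ext n
  rw [coeff_sect, map_neg]
  by_cases h : ∃ k, pentagonal (-k) * 5 = n
  · obtain ⟨k, rfl⟩ := h
    rw [mul_comm _ 5, ← key, coeff_pentagonalSeries_pentagonal, coeff_expand_mul,
      coeff_pentagonalSeries_pentagonal, ← Int.cast_neg]
    congr 1
    rw [(Int.negOnePow_eq_iff (5 * k + 1) (-k + 1)).2 ⟨3 * k, by ring⟩, Int.negOnePow_succ]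
    push_cast
    rfl
  · rw [coeff_pentagonalSeries_eq_zero, coeff_expand]
    · split_ifs with h5
      · rw [coeff_pentagonalSeries_eq_zero, neg_zero]
        rintro ⟨k, hk⟩
        exact h ⟨-k, by rw [neg_neg]; omega⟩
      · rw [neg_zero]
    · rintro ⟨k, hk⟩
      obtain ⟨m, hm⟩ : ∃ m, k = 5 * m ∨ k = 5 * m + 1 ∨ k = 5 * m + 2 ∨ k = 5 * m + 3 ∨
          k = 5 * m + 4 := ⟨k / 5, by omega⟩
      have h2 := two_mul_natCast_pentagonal k
      by_cases h1 : k = 5 * m + 1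
      · exact h ⟨m, by have := key m; rw [h1] at hk; omega⟩
      · generalize pentagonal k = N at *
        rcases hm with rfl | rfl | rfl | rfl | rfl <;> ring_nf at h2 <;> omega

/-- The five-dissection of Euler's product. -/
theorem pentagonalSeries_eq_dissection :
    pentagonalSeries R = expandFive (sect 0 (pentagonalSeries R))
      - X * expandFive (expandFive (pentagonalSeries R))
      + X ^ 2 * expandFive (sect 2 (pentagonalSeries R)) := by
  conv_lhs => rw [eq_sum_sect (pentagonalSeries R)]
  simp only [Finset.sum_range_succ, Finset.sum_range_zero,
    sect_pentagonalSeries_eq_zero R (r := 3) (by norm_num) (by norm_num),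
    sect_pentagonalSeries_eq_zero R (r := 4) (by norm_num) (by norm_num),
    sect_one_pentagonalSeries, map_neg, map_zero]
  ring

end

/-! ### Conjugates of Euler's product over the fifth roots of unity -/

section Norm

open scoped PowerSeries.WithPiTopology

theorem continuous_expand {R : Type*} [CommRing R] [TopologicalSpace R] (m : ℕ) (hm : m ≠ 0) :
    Continuous (expand m hm : R⟦X⟧ →ₐ[R] R⟦X⟧) := by
  rw [continuous_iff_continuousAt]
  intro f
  rw [ContinuousAt, WithPiTopology.tendsto_iff_coeff_tendsto]
  intro d
  simp only [coeff_expand]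
  split_ifs
  · exact (WithPiTopology.continuous_coeff R _).continuousAt
  · exact tendsto_const_nhds

/-- The product `∏ (1 - X ^ (m n))`, with its factors indexed by the multiples of `m` so that it can
be multiplied factor by factor with other products over all `n`. -/
theorem hasProd_expand {R : Type*} [CommRing R] [TopologicalSpace R] (m : ℕ) (hm : m ≠ 0) :
    HasProd (fun n : ℕ => if m ∣ n + 1 then (1 - X ^ (n + 1) : R⟦X⟧) else 1)
      (expand m hm (pentagonalSeries R)) := by
  have h := (WithPiTopology.hasProd_one_sub_X_pow R).map (expand m hm : R⟦X⟧ →ₐ[R] R⟦X⟧)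
    (continuous_expand m hm)
  have hinj : Function.Injective fun n : ℕ => m * n + (m - 1) := by
    intro a b hab
    simpa [hm] using hab
  rw [← hinj.hasProd_iff]
  · convert h using 1
    ext1 n
    have e : m * n + (m - 1) + 1 = m * (n + 1) := by
      have := Nat.pos_of_ne_zero hm
      rw [mul_add]; omega
    simp only [Function.comp_apply, e, dvd_mul_right, if_true, map_sub, map_one, map_pow, expand_X,
      pow_mul]
  · intro n hn
    rw [if_neg]
    rintro ⟨c, hc⟩
    refine hn ⟨c - 1, ?_⟩
    obtain ⟨c, rfl⟩ : ∃ c', c = c' + 1 := ⟨c - 1, by cases c <;> simp_all⟩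
    simp only [add_tsub_cancel_right]
    have := Nat.pos_of_ne_zero hm
    rw [mul_add] at hc; omega

theorem hasProd_rescale (ω : ℂ) :
    HasProd (fun n : ℕ => (1 - C (ω ^ (n + 1)) * X ^ (n + 1) : ℂ⟦X⟧))
      (rescale ω (pentagonalSeries ℂ)) := by
  have hc : Continuous (rescale ω : ℂ⟦X⟧ →+* ℂ⟦X⟧) := by
    rw [continuous_iff_continuousAt]
    intro f
    rw [ContinuousAt, WithPiTopology.tendsto_iff_coeff_tendsto]
    intro d
    simp only [coeff_rescale]
    exact ((WithPiTopology.continuous_coeff ℂ _).continuousAt).const_mul _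
  have h := (WithPiTopology.hasProd_one_sub_X_pow ℂ).map (rescale ω : ℂ⟦X⟧ →+* ℂ⟦X⟧) hc
  convert h using 1
  ext1 n
  simp [rescale_X, mul_pow]

/-- Over the fifth roots of unity, `∏ (1 - ωᵏ x)` equals `1 - x ^ 5`. -/
theorem prod_one_sub_root_mul {A : Type*} [CommRing A] (z x : A)
    (hz : z ^ 4 + z ^ 3 + z ^ 2 + z + 1 = 0) :
    (1 - x) * (1 - z * x) * (1 - z ^ 2 * x) * (1 - z ^ 3 * x) * (1 - z ^ 4 * x) = 1 - x ^ 5 := by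
  have h14 : (1 - z * x) * (1 - z ^ 4 * x) = 1 - (z + z ^ 4) * x + x ^ 2 := by
    linear_combination (x ^ 2 * (z - 1)) * hz
  have h23 : (1 - z ^ 2 * x) * (1 - z ^ 3 * x) = 1 - (z ^ 2 + z ^ 3) * x + x ^ 2 := by
    linear_combination (x ^ 2 * (z - 1)) * hz
  have hs : (z + z ^ 4) * (z ^ 2 + z ^ 3) = -1 := by
    linear_combination (z^3 - z + 1) * hz
  calc _ = (1 - x) * ((1 - z * x) * (1 - z ^ 4 * x)) * ((1 - z ^ 2 * x) * (1 - z ^ 3 * x)) := by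
        ring
    _ = _ := by
        rw [h14, h23]
        linear_combination (-(1 - x) * x * (1 + x ^ 2)) * hz + (1 - x) * x ^ 2 * hs

/-- The product of the conjugates `f(ωᵏ X)` of Euler's product. -/
theorem expand_mul_norm (ω : ℂ) (hω : IsPrimitiveRoot ω 5) :
    expandFive (expandFive (pentagonalSeries ℂ)) * (pentagonalSeries ℂ *
      rescale ω (pentagonalSeries ℂ) * rescale (ω ^ 2) (pentagonalSeries ℂ) *
      rescale (ω ^ 3) (pentagonalSeries ℂ) * rescale (ω ^ 4) (pentagonalSeries ℂ)) =
    expandFive (pentagonalSeries ℂ) ^ 6 := by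
  have h5 := (hasProd_expand (R := ℂ) 5 (by norm_num))
  have hD := h5.map (expandFive : ℂ⟦X⟧ →ₐ[ℂ] ℂ⟦X⟧) (continuous_expand 5 (by norm_num))
  have h1 := WithPiTopology.hasProd_one_sub_X_pow ℂ
  have h1' := h1.map (expandFive : ℂ⟦X⟧ →ₐ[ℂ] ℂ⟦X⟧) (continuous_expand 5 (by norm_num))
  have hL := hD.mul ((((h1.mul (hasProd_rescale ω)).mul (hasProd_rescale (ω ^ 2))).mul
    (hasProd_rescale (ω ^ 3))).mul (hasProd_rescale (ω ^ 4)))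
  have hR := h1'.mul ((((h5.mul h5).mul h5).mul h5).mul h5)
  rw [show expandFive (pentagonalSeries ℂ) ^ 6 = expandFive (pentagonalSeries ℂ) *
    (expandFive (pentagonalSeries ℂ) * expandFive (pentagonalSeries ℂ) *
      expandFive (pentagonalSeries ℂ) * expandFive (pentagonalSeries ℂ) *
      expandFive (pentagonalSeries ℂ)) by ring]
  refine hL.unique ?_
  convert hR using 1
  ext1 n
  simp only [Function.comp_apply, apply_ite (expandFive : ℂ⟦X⟧ →ₐ[ℂ] ℂ⟦X⟧), map_sub, map_one,
    map_pow, expand_X]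
  have e : ∀ k, (C ω ^ k : ℂ⟦X⟧) ^ (n + 1) = (C ω ^ (n + 1)) ^ k := fun k => by
    rw [← pow_mul, ← pow_mul, mul_comm]
  simp only [e]
  split_ifs with h
  · have hz : (C ω : ℂ⟦X⟧) ^ (n + 1) = 1 := by
      rw [← map_pow, (hω.pow_eq_one_iff_dvd _).2 h, map_one]
    simp only [hz, one_pow, one_mul]
  · have hp : IsPrimitiveRoot (ω ^ (n + 1)) 5 :=
      hω.pow_of_coprime _ ((Nat.Prime.coprime_iff_not_dvd (by norm_num)).2 h).symm
    have hz := hp.geom_sum_eq_zero (by norm_num)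
    rw [← map_pow]
    generalize ω ^ (n + 1) = z at hz
    have hz' : (C z : ℂ⟦X⟧) ^ 4 + C z ^ 3 + C z ^ 2 + C z + 1 = 0 := by
      simp only [Finset.sum_range_succ, Finset.sum_range_zero] at hz
      rw [← map_zero (C : ℂ →+* ℂ⟦X⟧), ← hz]
      simp only [map_add, map_pow, map_one, pow_zero, pow_one, map_zero]
      ring
    simp only [one_mul, mul_one]
    rw [prod_one_sub_root_mul (C z) (X ^ (n + 1)) hz', ← pow_mul, ← pow_mul, mul_comm 5]
end Norm

/-! ### Gaussian binomials and Jacobi's identity -/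

theorem two_mul_choose_two (k : ℕ) : 2 * (k + 1).choose 2 = k * (k + 1) := by
  induction k with
  | zero => rfl
  | succ k ih => rw [Nat.choose_succ_succ' (k + 1) 1, Nat.choose_one_right, mul_add, ih]; ring

section QBinomial
variable {A : Type*} [CommRing A]

/-- The Gaussian binomial coefficient, defined by the `q`-analogue of Pascal's rule. -/
def gaussBinom (q : A) : ℕ → ℕ → A
  | _, 0 => 1
  | 0, _ + 1 => 0
  | N + 1, j + 1 => gaussBinom q N j + q ^ (j + 1) * gaussBinom q N (j + 1)

/-- The finite product `(1 - q) (1 - q²) ⋯ (1 - qⁿ)`. -/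
def qFactor (q : A) (n : ℕ) : A := ∏ i ∈ Finset.range n, (1 - q ^ (i + 1))

theorem qFactor_succ (q : A) (n : ℕ) : qFactor q (n + 1) = qFactor q n * (1 - q ^ (n + 1)) :=
  Finset.prod_range_succ _ _

theorem gaussBinom_zero (q : A) (N : ℕ) : gaussBinom q N 0 = 1 := by
  cases N <;> rfl

theorem gaussBinom_eq_zero (q : A) {N j : ℕ} (h : N < j) : gaussBinom q N j = 0 := by
  induction N generalizing j with
  | zero => cases j with
    | zero => omega
    | succ j => rfl
  | succ N ih => cases j with
    | zero => omega
    | succ j => rw [gaussBinom, ih (by omega), ih (by omega)]; ring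

theorem gaussBinom_mul_qFactor (q : A) (a b : ℕ) :
    gaussBinom q (a + b) b * qFactor q b * qFactor q a = qFactor q (a + b) := by
  induction hN : a + b generalizing a b with
  | zero =>
    obtain rfl : a = 0 := by omega
    obtain rfl : b = 0 := by omega
    simp [gaussBinom, qFactor]
  | succ N ih =>
    cases b with
    | zero =>
      obtain rfl : a = N + 1 := by omega
      simp [gaussBinom, qFactor]
    | succ b =>
      have h1 := ih a b (by omega)
      rw [gaussBinom, qFactor_succ q b, qFactor_succ q N]
      cases a with
      | zero =>
        obtain rfl : b = N := by omega
        rw [gaussBinom_eq_zero q (Nat.lt_succ_self b)]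
        linear_combination (1 - q ^ (b + 1)) * h1
      | succ a =>
        have h2 := ih a (b + 1) (by omega)
        rw [qFactor_succ q a] at h1 ⊢
        rw [qFactor_succ q b] at h2
        obtain rfl : N = a + 1 + b := by omega
        linear_combination (1 - q ^ (b + 1)) * h1 + q ^ (b + 1) * (1 - q ^ (a + 1)) * h2

/-- Gauss's `q`-binomial theorem. -/
theorem prod_sub_mul_pow_eq_sum (q x y : A) (N : ℕ) :
    ∏ i ∈ Finset.range N, (y - x * q ^ i) = ∑ j ∈ Finset.range (N + 1),
      (-1) ^ j * q ^ (j.choose 2) * gaussBinom q N j * x ^ j * y ^ (N - j) := by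
  induction N generalizing x with
  | zero => simp [gaussBinom]
  | succ N ih =>
    have h : ∏ i ∈ Finset.range N, (y - x * q ^ (i + 1))
        = ∏ i ∈ Finset.range N, (y - (x * q) * q ^ i) :=
      Finset.prod_congr rfl fun i _ => by ring
    rw [Finset.prod_range_succ', h, ih, Finset.sum_range_succ' _ (N + 1), mul_sub, Finset.sum_mul,
      Finset.sum_mul]
    have hs : ∀ j ∈ Finset.range (N + 1), (-1) ^ (j + 1) * q ^ ((j + 1).choose 2) *
        gaussBinom q (N + 1) (j + 1) * x ^ (j + 1) * y ^ (N + 1 - (j + 1)) =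
        (-1) ^ (j + 1) * q ^ ((j + 1).choose 2) * (q ^ (j + 1) * gaussBinom q N (j + 1)) *
          x ^ (j + 1) * y ^ (N - j)
        - (-1) ^ j * q ^ (j.choose 2) * gaussBinom q N j * (x * q) ^ j * y ^ (N - j)
          * (x * q ^ 0) := by
      intro j _
      have : (j + 1).choose 2 = j + j.choose 2 := by
        rw [Nat.choose_succ_succ' j 1, Nat.choose_one_right]
      rw [gaussBinom, this, Nat.add_sub_add_right]
      ring
    rw [Finset.sum_congr rfl hs, Finset.sum_sub_distrib, sub_add_eq_add_sub]
    congr 1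
    conv_lhs => rw [← Finset.sum_mul, Finset.sum_range_succ', add_mul, Finset.sum_mul]
    conv_rhs => rw [Finset.sum_range_succ, gaussBinom_eq_zero q (Nat.lt_succ_self N)]
    simp only [gaussBinom_zero]
    have hs' : ∀ j ∈ Finset.range N, (-1) ^ (j + 1) * q ^ (j + 1).choose 2 *
        gaussBinom q N (j + 1) * (x * q) ^ (j + 1) * y ^ (N - (j + 1)) * y =
        (-1) ^ (j + 1) * q ^ (j + 1).choose 2 * (q ^ (j + 1) * gaussBinom q N (j + 1)) *
          x ^ (j + 1) * y ^ (N - j) := by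
      intro j hj
      obtain ⟨c, rfl⟩ : ∃ c, N = j + 1 + c := Nat.exists_eq_add_of_lt (Finset.mem_range.1 hj) |>.imp
        fun c h => by omega
      rw [show j + 1 + c - (j + 1) = c by omega, show j + 1 + c - j = c + 1 by omega]
      ring
    rw [Finset.sum_congr rfl hs']
    simp [pow_succ]

/-- The derivative of Gauss's identity with `2n + 1` factors `qⁿ - z qⁱ`, at the simple zero
`z = 1`. -/
theorem sum_gaussBinom_mul_self (q : A) (n : ℕ) :
    ∑ j ∈ Finset.range (2 * n + 2), (-1) ^ j * q ^ (j.choose 2) * gaussBinom q (2 * n + 1) j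
      * j * (q ^ n) ^ (2 * n + 1 - j) =
    - q ^ n * ((∏ i ∈ Finset.range n, (q ^ n - q ^ i)) *
      ∏ i ∈ Finset.range n, (q ^ n - q ^ (n + 1 + i))) := by
  have hC : ∀ N j, gaussBinom (Polynomial.C q) N j = Polynomial.C (gaussBinom q N j) := by
    intro N
    induction N with
    | zero => intro j; cases j <;> simp [gaussBinom]
    | succ N ih => intro j; cases j <;> simp [gaussBinom, ih]
  have h := prod_sub_mul_pow_eq_sum (Polynomial.C q) (Polynomial.X : Polynomial A)
    (Polynomial.C q ^ n) (2 * n + 1)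
  have hprod : ∏ i ∈ Finset.range (2 * n + 1),
      (Polynomial.C q ^ n - Polynomial.X * Polynomial.C q ^ i) =
      (Polynomial.C (q ^ n) * (1 - Polynomial.X)) *
      ((∏ i ∈ Finset.range n, (Polynomial.C q ^ n - Polynomial.X * Polynomial.C q ^ i)) *
        ∏ i ∈ Finset.range n,
          (Polynomial.C q ^ n - Polynomial.X * Polynomial.C q ^ (n + 1 + i))) := by
    rw [show 2 * n + 1 = (n + 1) + n by ring, Finset.prod_range_add, Finset.prod_range_succ,
      Polynomial.C_pow]
    ring
  have hsum : ∑ j ∈ Finset.range (2 * n + 1 + 1), (-1) ^ j * Polynomial.C q ^ (j.choose 2) *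
      gaussBinom (Polynomial.C q) (2 * n + 1) j * Polynomial.X ^ j *
        (Polynomial.C q ^ n) ^ (2 * n + 1 - j) =
      ∑ j ∈ Finset.range (2 * n + 2), Polynomial.C ((-1) ^ j * q ^ (j.choose 2) *
        gaussBinom q (2 * n + 1) j * (q ^ n) ^ (2 * n + 1 - j)) * Polynomial.X ^ j := by
    refine Finset.sum_congr rfl fun j _ => ?_
    simp only [hC, Polynomial.C_mul, Polynomial.C_pow, Polynomial.C_neg, Polynomial.C_1]
    ring
  rw [hprod, hsum] at h
  have h' := congrArg (fun p => (Polynomial.derivative p).eval 1) h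
  simp only [Polynomial.derivative_mul, Polynomial.derivative_sum, Polynomial.eval_add,
    Polynomial.eval_mul, Polynomial.eval_finsetSum, Polynomial.derivative_X_pow,
    Polynomial.derivative_sub, Polynomial.derivative_one, Polynomial.derivative_X,
    Polynomial.derivative_C, Polynomial.eval_C, Polynomial.eval_pow, Polynomial.eval_X,
    Polynomial.eval_sub, Polynomial.eval_one, Polynomial.eval_prod, Polynomial.eval_zero] at h'
  simp only [one_pow, sub_self, mul_zero, zero_mul, zero_add, add_zero, zero_sub, mul_one,
    one_mul, mul_neg] at h'
  rw [neg_mul, ← neg_mul, h']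
  exact Finset.sum_congr rfl fun j _ => by ring

theorem gaussBinom_symm [IsDomain A] {q : A} (hq : ∀ n, qFactor q n ≠ 0) (a b : ℕ) :
    gaussBinom q (a + b) a = gaussBinom q (a + b) b := by
  have h1 := gaussBinom_mul_qFactor q a b
  have h2 := gaussBinom_mul_qFactor q b a
  rw [add_comm b a] at h2
  refine mul_right_cancel₀ (hq a) (mul_right_cancel₀ (hq b) ?_)
  rw [h2, ← h1]
  ring

theorem prod_pow_sub_pow (q : A) (n : ℕ) :
    ∏ i ∈ Finset.range n, (q ^ n - q ^ i) = (-1) ^ n * q ^ (n.choose 2) * qFactor q n := by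
  have h : ∀ i ∈ Finset.range n, q ^ n - q ^ i = -1 * q ^ i * (1 - q ^ (n - 1 - i + 1)) := by
    intro i hi
    obtain ⟨c, rfl⟩ := Nat.exists_eq_add_of_lt (Finset.mem_range.1 hi)
    rw [show i + c + 1 - 1 - i = c by omega]
    ring
  rw [Finset.prod_congr rfl h, Finset.prod_mul_distrib, Finset.prod_mul_distrib,
    Finset.prod_const, Finset.card_range, Finset.prod_pow_eq_pow_sum, Finset.sum_range_id,
    ← Nat.choose_two_right, Finset.prod_range_reflect (fun i => 1 - q ^ (i + 1))]
  rfl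

/-- The finite form of Jacobi's identity for the cube of Euler's product. -/
theorem sum_mul_gaussBinom_eq_qFactor_sq [IsDomain A] {q : A} (hq : q ≠ 0)
    (hq' : ∀ n, qFactor q n ≠ 0) (n : ℕ) :
    ∑ k ∈ Finset.range (n + 1), (-1) ^ k * (2 * k + 1) * q ^ ((k + 1).choose 2) *
      gaussBinom q (2 * n + 1) (n - k) = qFactor q n ^ 2 := by
  have h := sum_gaussBinom_mul_self q n
  have h2 : ∏ i ∈ Finset.range n, (q ^ n - q ^ (n + 1 + i)) = q ^ (n * n) * qFactor q n := by
    have : ∀ i ∈ Finset.range n, q ^ n - q ^ (n + 1 + i) = q ^ n * (1 - q ^ (i + 1)) :=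
      fun i _ => by ring
    rw [Finset.prod_congr rfl this, Finset.prod_mul_distrib, Finset.prod_const, Finset.card_range,
      ← pow_mul]
    rfl
  rw [prod_pow_sub_pow, h2, show 2 * n + 2 = n + 1 + (n + 1) by ring, Finset.sum_range_add,
    ← Finset.sum_range_reflect, ← Finset.sum_add_distrib] at h
  -- The terms of index `n - k` and `n + 1 + k` carry the same power of `q`.
  have hterm : ∀ k ∈ Finset.range (n + 1),
      (-1) ^ (n + 1 - 1 - k) * q ^ ((n + 1 - 1 - k).choose 2) *
          gaussBinom q (2 * n + 1) (n + 1 - 1 - k) * ((n + 1 - 1 - k : ℕ) : A) *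
          (q ^ n) ^ (2 * n + 1 - (n + 1 - 1 - k)) +
        (-1) ^ (n + 1 + k) * q ^ ((n + 1 + k).choose 2) * gaussBinom q (2 * n + 1) (n + 1 + k) *
          ((n + 1 + k : ℕ) : A) * (q ^ n) ^ (2 * n + 1 - (n + 1 + k)) =
      (-(-1) ^ n * q ^ (n + n.choose 2 + n * n)) * ((-1) ^ k * (2 * k + 1) *
        q ^ ((k + 1).choose 2) * gaussBinom q (2 * n + 1) (n - k)) := by
    intro k hk
    obtain ⟨c, rfl⟩ := Nat.exists_eq_add_of_le (Nat.lt_succ_iff.1 (Finset.mem_range.1 hk))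
    have hsymm := gaussBinom_symm hq' (k + c + 1 + k) c
    rw [show k + c + 1 + k + c = 2 * (k + c) + 1 by ring] at hsymm
    rw [show k + c + 1 - 1 - k = c by omega, show k + c - k = c by omega, hsymm,
      show 2 * (k + c) + 1 - c = k + c + 1 + k by omega,
      show 2 * (k + c) + 1 - (k + c + 1 + k) = c by omega]
    have hc : ∀ m : ℕ, 2 * ((m.choose 2 : ℕ) : ℤ) = m * (m - 1) := by
      intro m
      cases m with
      | zero => simp
      | succ m => have := two_mul_choose_two m; push_cast; zify at this; linear_combination this
    have e1 : c.choose 2 + (k + c) * (k + c + 1 + k) =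
        k + c + (k + c).choose 2 + (k + c) * (k + c) + (k + 1).choose 2 := by
      have h1 := hc c
      have h2 := hc (k + c)
      have h3 := hc (k + 1)
      zify
      push_cast at h2 h3
      linarith
    have e2 : (k + c + 1 + k).choose 2 + (k + c) * c =
        k + c + (k + c).choose 2 + (k + c) * (k + c) + (k + 1).choose 2 := by
      have h1 := hc (k + c + 1 + k)
      have h2 := hc (k + c)
      have h3 := hc (k + 1)
      zify
      push_cast at h1 h2 h3
      linarith
    set Q := q ^ (k + c + (k + c).choose 2 + (k + c) * (k + c)) with hQ
    have p1 : q ^ c.choose 2 * (q ^ (k + c)) ^ (k + c + 1 + k) = Q * q ^ (k + 1).choose 2 := by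
      rw [← pow_mul, ← pow_add, e1, pow_add]
    have p2 : q ^ (k + c + 1 + k).choose 2 * (q ^ (k + c)) ^ c = Q * q ^ (k + 1).choose 2 := by
      rw [← pow_mul, ← pow_add, e2, pow_add]
    have s1 : (-1 : A) ^ k * (-1) ^ k = 1 := by rw [← mul_pow]; simp
    clear_value Q
    push_cast
    generalize gaussBinom q (2 * (k + c) + 1) c = g
    linear_combination (-1) ^ c * g * c * p1 + (-1) ^ (k + c + 1 + k) * g * (k + c + 1 + k) * p2
      - (-1) ^ c * g * c * Q * q ^ (k + 1).choose 2 * s1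
  rw [Finset.sum_congr rfl hterm, ← Finset.mul_sum] at h
  have hne : -(-1 : A) ^ n * q ^ (n + n.choose 2 + n * n) ≠ 0 :=
    mul_ne_zero (neg_ne_zero.2 (pow_ne_zero _ (neg_ne_zero.2 one_ne_zero))) (pow_ne_zero _ hq)
  refine mul_left_cancel₀ hne (h.trans ?_)
  ring
end QBinomial

/-- Modulo `X ^ (n + 1)`, Euler's product agrees with its first `n` factors. -/
theorem X_pow_dvd_pentagonalSeries_sub_qFactor (n : ℕ) :
    (X : ℤ⟦X⟧) ^ (n + 1) ∣ pentagonalSeries ℤ - qFactor X n := by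
  have h : ∀ m, (X : ℤ⟦X⟧) ^ (n + 1) ∣ qFactor X (n + m) - qFactor X n := by
    intro m
    induction m with
    | zero => simp
    | succ m ih =>
      rw [← add_assoc, qFactor_succ, mul_sub, mul_one, sub_right_comm]
      exact dvd_sub ih (Dvd.dvd.mul_left (pow_dvd_pow _ (by omega)) _)
  rw [X_pow_dvd_iff]
  intro d hd
  have h1 := Filter.tendsto_finset_range.eventually (coeff_prod_one_sub_X_pow_eventually_eq ℤ d)
  obtain ⟨m, hm, hm'⟩ := (h1.and (Filter.eventually_ge_atTop n)).exists
  obtain ⟨c, rfl⟩ := Nat.exists_eq_add_of_le hm'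
  rw [map_sub, ← hm]
  exact (map_sub (coeff d) _ _).symm.trans (X_pow_dvd_iff.1 (h c) d hd)

/-- The cube of Euler's product has only exponents that are triangular numbers (Jacobi), and no
triangular number is congruent to `2` modulo `5`. -/
theorem sect_two_pentagonalSeries_pow_three : sect 2 (pentagonalSeries ℤ ^ 3) = 0 := by
  ext r
  rw [coeff_sect, map_zero]
  obtain ⟨m, hm⟩ : ∃ m, m = 5 * r + 2 := ⟨_, rfl⟩
  rw [← hm]
  set E := pentagonalSeries ℤ with hE
  have hd : ∀ N i, N ≤ i → (X : ℤ⟦X⟧) ^ (N + 1) ∣ E - qFactor X i := fun N i h =>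
    (pow_dvd_pow _ (by omega)).trans (X_pow_dvd_pentagonalSeries_sub_qFactor i)
  -- Modulo `X ^ (m - k + 1)` the Gaussian binomial is the inverse of Euler's product.
  have hG : ∀ k ≤ m, (X : ℤ⟦X⟧) ^ (m - k + 1) ∣ gaussBinom X (2 * m + 1) (m - k) * E - 1 := by
    intro k hk
    have h := gaussBinom_mul_qFactor (X : ℤ⟦X⟧) (m + k + 1) (m - k)
    rw [show m + k + 1 + (m - k) = 2 * m + 1 by omega] at h
    have h1 := hd (m - k) (m - k) le_rfl
    have h2 := hd (m - k) (m + k + 1) (by omega)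
    have h3 := hd (m - k) (2 * m + 1) (by omega)
    have hu : partitionSeries * E = 1 := partitionSeries_mul_pentagonalSeries
    obtain ⟨c1, h1⟩ := h1
    obtain ⟨c2, h2⟩ := h2
    obtain ⟨c3, h3⟩ := h3
    generalize gaussBinom (X : ℤ⟦X⟧) (2 * m + 1) (m - k) = g at *
    rw [show qFactor (X : ℤ⟦X⟧) (m - k) = E - X ^ (m - k + 1) * c1 by rw [← h1]; ring,
      show qFactor (X : ℤ⟦X⟧) (m + k + 1) = E - X ^ (m - k + 1) * c2 by rw [← h2]; ring,
      show qFactor (X : ℤ⟦X⟧) (2 * m + 1) = E - X ^ (m - k + 1) * c3 by rw [← h3]; ring] at h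
    generalize (X : ℤ⟦X⟧) ^ (m - k + 1) = x at *
    refine ⟨partitionSeries * (g * (E * c2 + E * c1 - x * c1 * c2) - c3), ?_⟩
    linear_combination partitionSeries * h - (g * E - 1) * hu
  have hJ := sum_mul_gaussBinom_eq_qFactor_sq (X_ne_zero (R := ℤ)) (fun n h => by
    have := congrArg constantCoeff h
    simp [qFactor] at this) m
  have hcube : (X : ℤ⟦X⟧) ^ (m + 1) ∣ E ^ 3 - qFactor X m ^ 2 * E := by
    obtain ⟨c, hc⟩ := hd m m le_rfl
    exact ⟨c * (E + qFactor X m) * E, by linear_combination (E + qFactor X m) * E * hc⟩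
  have h0 := X_pow_dvd_iff.1 hcube m (Nat.lt_succ_self m)
  rw [map_sub, sub_eq_zero] at h0
  rw [h0, ← hJ, Finset.sum_mul, map_sum]
  refine Finset.sum_eq_zero fun k hk => ?_
  have hk' : k ≤ m := Nat.lt_succ_iff.1 (Finset.mem_range.1 hk)
  have htri : (k + 1).choose 2 ≠ m := by
    intro h
    have h2 := two_mul_choose_two k
    rw [h] at h2
    obtain ⟨t, ht⟩ : ∃ t, k = 5 * t ∨ k = 5 * t + 1 ∨ k = 5 * t + 2 ∨ k = 5 * t + 3 ∨
      k = 5 * t + 4 := ⟨k / 5, by omega⟩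
    clear_value E
    clear h hJ hcube h0 hG hd hk hk'
    rcases ht with rfl | rfl | rfl | rfl | rfl <;> ring_nf at h2 <;> omega
  have hle : k ≤ (k + 1).choose 2 := by
    rw [Nat.choose_succ_succ' k 1, Nat.choose_one_right]; omega
  rw [show (-1 : ℤ⟦X⟧) ^ k * (2 * (k : ℤ⟦X⟧) + 1) * X ^ ((k + 1).choose 2) *
      gaussBinom X (2 * m + 1) (m - k) * E = C ((-1) ^ k * (2 * (k : ℤ) + 1)) *
      ((gaussBinom X (2 * m + 1) (m - k) * E) * X ^ ((k + 1).choose 2)) by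
    simp only [map_mul, map_add, map_pow, map_neg, map_one, map_natCast, map_ofNat]; ring,
    coeff_C_mul, coeff_mul_X_pow']
  split_ifs with h
  · have h4 := X_pow_dvd_iff.1 (hG k hk') (m - (k + 1).choose 2) (by omega)
    rw [map_sub, sub_eq_zero, coeff_one, if_neg (by omega)] at h4
    rw [h4, mul_zero]
  · rw [mul_zero]

/-! ### The quintic equation of Euler's product -/

section Dissection

/-- The outer components of the five-dissection of Euler's product have product `-f(X⁵)²`. -/
theorem sect_zero_mul_sect_two_pentagonalSeries :
    sect 0 (pentagonalSeries ℤ) * sect 2 (pentagonalSeries ℤ) =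
      - expandFive (pentagonalSeries ℤ) ^ 2 := by
  have hE := pentagonalSeries_eq_dissection ℤ
  have h := sect_two_pentagonalSeries_pow_three
  have ha : sect 0 (pentagonalSeries ℤ) ≠ 0 := by
    intro h0
    have := congrArg (coeff 0) h0
    rw [coeff_sect, coeff_zero_eq_constantCoeff_apply, constantCoeff_pentagonalSeries] at this
    simp at this
  generalize sect 0 (pentagonalSeries ℤ) = a at *
  generalize sect 2 (pentagonalSeries ℤ) = c at *
  generalize expandFive (pentagonalSeries ℤ) = d at *
  have h3 : pentagonalSeries ℤ ^ 3 = expandFive (a ^ 3) * X ^ 0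
      + expandFive (-3 * a ^ 2 * d) * X ^ 1
      + expandFive (3 * a ^ 2 * c + 3 * a * d ^ 2) * X ^ 2
      + expandFive (- d ^ 3 - 6 * a * d * c) * X ^ 3
      + expandFive (3 * a * c ^ 2 + 3 * d ^ 2 * c) * X ^ 4
      + expandFive (-3 * d * c ^ 2) * X ^ 5 + expandFive (c ^ 3) * X ^ 6 := by
    rw [hE]
    simp only [map_add, map_sub, map_mul, map_pow, map_neg, map_ofNat]
    ring
  rw [h3] at h
  simp only [LinearMap.map_add, sect_expandFive_mul_X_pow (show 2 < 5 by norm_num), Nat.reduceMod,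
    Nat.reduceDiv, Nat.reduceEqDiff, if_true, if_false] at h
  have h' : (3 * a) * (a * c + d ^ 2) = 0 := by linear_combination h
  have := (mul_eq_zero.1 h').resolve_left (mul_ne_zero (fun h => by
    have := congrArg constantCoeff h
    rw [map_ofNat, map_zero] at this
    norm_num at this) ha)
  linear_combination this

theorem expandFive_injective {R : Type*} [CommRing R] :
    Function.Injective (expandFive : R⟦X⟧ →ₐ[R] R⟦X⟧) := by
  intro f g h
  ext n
  rw [← coeff_expand_mul 5 (by norm_num) f n, ← coeff_expand_mul 5 (by norm_num) g n]
  exact congrArg (coeff (5 * n)) h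

theorem map_pentagonalSeries {R S : Type*} [CommRing R] [CommRing S] (φ : R →+* S) :
    PowerSeries.map φ (pentagonalSeries R) = pentagonalSeries S := by
  ext n
  rw [coeff_map]
  by_cases h : n ∈ Set.range pentagonal
  · obtain ⟨k, rfl⟩ := h
    simp
  · rw [coeff_pentagonalSeries_eq_zero R h, coeff_pentagonalSeries_eq_zero S h, map_zero]

theorem map_sect {R S : Type*} [CommRing R] [CommRing S] (φ : R →+* S) (r : ℕ) (f : R⟦X⟧) :
    PowerSeries.map φ (sect r f) = sect r (PowerSeries.map φ f) := by
  ext n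
  simp

theorem rescale_expandFive {ω : ℂ} (hω : ω ^ 5 = 1) (f : ℂ⟦X⟧) :
    rescale ω (expandFive f) = expandFive f := by
  ext n
  rw [coeff_rescale, coeff_expand]
  split_ifs with h
  · obtain ⟨m, rfl⟩ := h
    rw [pow_mul, hω, one_pow, one_mul]
  · rw [mul_zero]

/-- The norm of `A - p + r` over the fifth roots of unity, when `A r = -p²`. -/
theorem norm_dissection {B : Type*} [CommRing B] (z A p r : B)
    (hz : z ^ 4 + z ^ 3 + z ^ 2 + z + 1 = 0) (h : A * r = - p ^ 2) :
    (A - p + r) * (A - z * p + z ^ 2 * r) * (A - z ^ 2 * p + z ^ 4 * r) *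
      (A - z ^ 3 * p + z ^ 6 * r) * (A - z ^ 4 * p + z ^ 8 * r) =
    A ^ 5 - 11 * p ^ 5 + r ^ 5 := by
  have h5 : z ^ 5 = 1 := by linear_combination (z - 1) * hz
  have h6 : z ^ 6 = z := by linear_combination z * h5
  have h8 : z ^ 8 = z ^ 3 := by linear_combination z ^ 3 * h5
  rw [h6, h8]
  obtain ⟨s, hs⟩ : ∃ s, s = z + z ^ 4 := ⟨_, rfl⟩
  obtain ⟨t, ht⟩ : ∃ t, t = z ^ 2 + z ^ 3 := ⟨_, rfl⟩
  have hst : s + t = -1 := by rw [hs, ht]; linear_combination hz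
  have hst' : s * t = -1 := by
    rw [hs, ht]; linear_combination (z ^ 3 - z + 1) * hz
  have h14 : (A - z * p + z ^ 2 * r) * (A - z ^ 4 * p + z ^ 3 * r) =
      A ^ 2 + r ^ 2 - s * (p * (A + r)) + (1 - t) * p ^ 2 := by
    rw [hs, ht]
    linear_combination (z ^ 2 + z ^ 3) * h + (p ^ 2 - z * p * r + r ^ 2) * h5
  have h23 : (A - z ^ 2 * p + z ^ 4 * r) * (A - z ^ 3 * p + z * r) =
      A ^ 2 + r ^ 2 - t * (p * (A + r)) + (1 - s) * p ^ 2 := by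
    rw [hs, ht]
    linear_combination (z + z ^ 4) * h + (p ^ 2 - z ^ 2 * p * r + r ^ 2) * h5
  have hq : (A ^ 2 + r ^ 2 - s * (p * (A + r)) + (1 - t) * p ^ 2) *
      (A ^ 2 + r ^ 2 - t * (p * (A + r)) + (1 - s) * p ^ 2) =
      (A ^ 2 + r ^ 2) ^ 2 + (A ^ 2 + r ^ 2) * (p * (A + r)) + 3 * ((A ^ 2 + r ^ 2) * p ^ 2)
        - (p * (A + r)) ^ 2 + 4 * ((p * (A + r)) * p ^ 2) + (p ^ 2) ^ 2 := by
    obtain rfl : t = -1 - s := by linear_combination hst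
    linear_combination ((p * (A + r)) ^ 2 - 2 * (p * (A + r)) * p ^ 2 + (p ^ 2) ^ 2) * hst'
  calc _ = (A - p + r) * (((A - z * p + z ^ 2 * r) * (A - z ^ 4 * p + z ^ 3 * r)) *
        ((A - z ^ 2 * p + z ^ 4 * r) * (A - z ^ 3 * p + z * r))) := by ring
    _ = _ := by
      rw [h14, h23, hq]
      linear_combination (r ^ 3 + 2 * p * r ^ 2 - 3 * p ^ 2 * r + 10 * p ^ 3 + 2 * A * r ^ 2
        - 3 * A * p ^ 2 + 2 * A ^ 2 * r + 2 * A ^ 2 * p + A ^ 3) * h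

/-- The norm of Euler's product, in terms of its five-dissection. -/
theorem expandFive_mul_norm_eq_pow_six :
    expandFive (pentagonalSeries ℤ) * (sect 0 (pentagonalSeries ℤ) ^ 5
      - 11 * X * expandFive (pentagonalSeries ℤ) ^ 5 + X ^ 2 * sect 2 (pentagonalSeries ℤ) ^ 5) =
    pentagonalSeries ℤ ^ 6 := by
  -- The fifth roots of unity are adjoined by passing to `ℂ`.
  have hinj : Function.Injective (PowerSeries.map (Int.castRingHom ℂ)) :=
    PowerSeries.map_injective _ Int.cast_injective
  refine expandFive_injective (hinj ?_)
  have hω := Complex.isPrimitiveRoot_exp 5 (by norm_num)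
  generalize Complex.exp (2 * Real.pi * Complex.I / (5 : ℕ)) = ω at hω
  have hN := expand_mul_norm ω hω
  have hac := congrArg (PowerSeries.map (Int.castRingHom ℂ)) sect_zero_mul_sect_two_pentagonalSeries
  simp only [map_mul, map_sub, map_add, map_pow, map_neg, map_ofNat, map_sect, map_expand,
    map_pentagonalSeries, expand_X, PowerSeries.map_X] at hac ⊢
  have hE := pentagonalSeries_eq_dissection ℂ
  have hA := congrArg (expandFive : ℂ⟦X⟧ →ₐ[ℂ] ℂ⟦X⟧) hac
  simp only [map_mul, map_neg, map_pow] at hA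
  generalize sect 0 (pentagonalSeries ℂ) = a at *
  generalize sect 2 (pentagonalSeries ℂ) = c at *
  have hr : ∀ k, rescale (ω ^ k) (pentagonalSeries ℂ) = expandFive a
      - C ω ^ k * (X * expandFive (expandFive (pentagonalSeries ℂ)))
      + C ω ^ (2 * k) * (X ^ 2 * expandFive c) := by
    intro k
    have hk : (ω ^ k) ^ 5 = 1 := by rw [← pow_mul, mul_comm, pow_mul, hω.pow_eq_one, one_pow]
    conv_lhs => rw [hE]
    simp only [map_add, map_sub, map_mul, map_pow, rescale_expandFive hk, rescale_X]
    ring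
  have h1 := hr 1
  rw [pow_one] at h1
  have hz : (C ω : ℂ⟦X⟧) ^ 4 + C ω ^ 3 + C ω ^ 2 + C ω + 1 = 0 := by
    have hz := hω.geom_sum_eq_zero (by norm_num)
    simp only [Finset.sum_range_succ, Finset.sum_range_zero] at hz
    rw [← map_zero (C : ℂ →+* ℂ⟦X⟧), ← hz]
    simp only [map_add, map_pow, map_one, pow_zero, pow_one, map_zero]
    ring
  have hn := norm_dissection (C ω) (expandFive a)
    (X * expandFive (expandFive (pentagonalSeries ℂ))) (X ^ 2 * expandFive c) hz
    (by linear_combination X ^ 2 * hA)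
  rw [← hN, h1, hr 2, hr 3, hr 4]
  have hE' : pentagonalSeries ℂ = expandFive a
    - X * expandFive (expandFive (pentagonalSeries ℂ)) + X ^ 2 * expandFive c := hE
  generalize expandFive (expandFive (pentagonalSeries ℂ)) = D at *
  rw [hE']
  linear_combination (-D) * hn

/-- The quotient `f / (X f(X²⁵))` is a root of a quintic with coefficients in the series in `X⁵`,
written here without denominators. -/
theorem quintic_pentagonalSeries :
    expandFive (expandFive (pentagonalSeries ℤ)) * (pentagonalSeries ℤ ^ 5
      + 5 * pentagonalSeries ℤ ^ 4 * (X * expandFive (expandFive (pentagonalSeries ℤ)))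
      + 15 * pentagonalSeries ℤ ^ 3 * (X * expandFive (expandFive (pentagonalSeries ℤ))) ^ 2
      + 25 * pentagonalSeries ℤ ^ 2 * (X * expandFive (expandFive (pentagonalSeries ℤ))) ^ 3
      + 25 * pentagonalSeries ℤ * (X * expandFive (expandFive (pentagonalSeries ℤ))) ^ 4) =
    expandFive (pentagonalSeries ℤ) ^ 6 := by
  have hac := congrArg (expandFive : ℤ⟦X⟧ →ₐ[ℤ] ℤ⟦X⟧) sect_zero_mul_sect_two_pentagonalSeries
  have hN := congrArg (expandFive : ℤ⟦X⟧ →ₐ[ℤ] ℤ⟦X⟧) expandFive_mul_norm_eq_pow_six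
  have hE := pentagonalSeries_eq_dissection ℤ
  simp only [map_mul, map_sub, map_add, map_pow, map_neg, map_ofNat, expand_X] at hac hN
  rw [← hN]
  generalize expandFive (expandFive (pentagonalSeries ℤ)) = D at *
  generalize expandFive (sect 0 (pentagonalSeries ℤ)) = A at *
  generalize expandFive (sect 2 (pentagonalSeries ℤ)) = c at *
  rw [hE]
  obtain ⟨p, hp⟩ : ∃ p, p = X * D := ⟨_, rfl⟩
  obtain ⟨r, hr⟩ : ∃ r, r = X ^ 2 * c := ⟨_, rfl⟩
  have h : A * r = - p ^ 2 := by rw [hp, hr]; linear_combination X ^ 2 * hac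
  have h11 : A ^ 5 - 11 * X ^ 5 * D ^ 5 + (X ^ 5) ^ 2 * c ^ 5 = A ^ 5 - 11 * p ^ 5 + r ^ 5 := by
    rw [hp, hr]; ring
  rw [h11, ← hp, ← hr]
  linear_combination D * (5 * r ^ 3 + 5 * p ^ 2 * r + 10 * A * r ^ 2 + 5 * A * p ^ 2
    + 10 * A ^ 2 * r + 5 * A ^ 3) * h

end Dissection

/-! ### The modular equation and zeroth sections of powers -/

section Recurrence

/-- The polynomials `Mᵢ` for which `u ^ (i - 4)` has zeroth section `Mᵢ(w)`; the recurrence is that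
of the powers of a root of the quintic equation satisfied by `u`. -/
noncomputable def sectPoly : ℕ → Polynomial ℤ
  | 0 => -5
  | 1 => 5
  | 2 => -1
  | 3 => -1
  | 4 => 1
  | i + 5 => Polynomial.X * (25 * sectPoly (i + 4) + 25 * sectPoly (i + 3) + 15 * sectPoly (i + 2)
      + 5 * sectPoly (i + 1) + sectPoly i)

/-- The series `u = q f(q²⁵) / f(q)`, where `f` is Euler's product. -/
noncomputable def uSeries : ℤ⟦X⟧ :=
  X * expandFive (expandFive (pentagonalSeries ℤ)) * partitionSeries

/-- The series `w = q f(q⁵)⁶ / f(q)⁶`, where `f` is Euler's product. -/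
noncomputable def wSeries : ℤ⟦X⟧ :=
  X * expandFive (pentagonalSeries ℤ) ^ 6 * partitionSeries ^ 6

theorem expandFive_wSeries : expandFive wSeries = X ^ 5 *
    expandFive (expandFive (pentagonalSeries ℤ)) ^ 6 * expandFive partitionSeries ^ 6 := by
  simp only [wSeries, map_mul, map_pow, expand_X]

theorem expandFive_partitionSeries_mul :
    expandFive partitionSeries * expandFive (pentagonalSeries ℤ) = 1 := by
  rw [← map_mul, partitionSeries_mul_pentagonalSeries, map_one]

theorem expandFive_wSeries_mul : expandFive wSeries * wSeries = uSeries ^ 6 := by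
  rw [expandFive_wSeries, wSeries, uSeries]
  have h : (expandFive partitionSeries * expandFive (pentagonalSeries ℤ)) ^ 6 = 1 := by
    rw [expandFive_partitionSeries_mul, one_pow]
  linear_combination (X * expandFive (expandFive (pentagonalSeries ℤ)) * partitionSeries) ^ 6 * h

/-- The modular equation relating `u` to `w(q⁵)`. -/
theorem uSeries_pow_five : uSeries ^ 5 = expandFive wSeries *
    (25 * uSeries ^ 4 + 25 * uSeries ^ 3 + 15 * uSeries ^ 2 + 5 * uSeries + 1) := by
  have hq := quintic_pentagonalSeries
  have hG := partitionSeries_mul_pentagonalSeries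
  have hD := expandFive_partitionSeries_mul
  rw [expandFive_wSeries, uSeries]
  generalize expandFive (expandFive (pentagonalSeries ℤ)) = D at *
  generalize expandFive (pentagonalSeries ℤ) = d at *
  generalize pentagonalSeries ℤ = E at *
  generalize partitionSeries = G at *
  generalize expandFive G = H at *
  have hG2 : G ^ 2 * E ^ 2 = 1 := by rw [← mul_pow, hG, one_pow]
  have hG3 : G ^ 3 * E ^ 3 = 1 := by rw [← mul_pow, hG, one_pow]
  have hG4 : G ^ 4 * E ^ 4 = 1 := by rw [← mul_pow, hG, one_pow]
  have hG5 : G ^ 5 * E ^ 5 = 1 := by rw [← mul_pow, hG, one_pow]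
  have hH : H ^ 6 * d ^ 6 = 1 := by rw [← mul_pow, hD, one_pow]
  linear_combination (-X ^ 5 * D ^ 5 * H ^ 6 * G ^ 5) * hq - (X ^ 5 * D ^ 5 * G ^ 5) * hH
    + (X ^ 5 * D ^ 6 * H ^ 6) * (hG5 + 5 * (X * D * G) * hG4 + 15 * (X * D * G) ^ 2 * hG3
      + 25 * (X * D * G) ^ 3 * hG2 + 25 * (X * D * G) ^ 4 * hG)

/-- The zeroth sections of the first powers of Euler's product, suitably shifted. -/
theorem sect_zero_X_pow_mul_pentagonalSeries_pow :
    sect 0 (X * pentagonalSeries ℤ ^ 4) = -5 * (X * expandFive (pentagonalSeries ℤ) ^ 4) ∧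
    sect 0 (X ^ 2 * pentagonalSeries ℤ ^ 3) = 5 * (X * expandFive (pentagonalSeries ℤ) ^ 3) ∧
    sect 0 (X ^ 3 * pentagonalSeries ℤ ^ 2) = -(X * expandFive (pentagonalSeries ℤ) ^ 2) ∧
    sect 0 (X ^ 4 * pentagonalSeries ℤ) = -(X * expandFive (pentagonalSeries ℤ)) := by
  have hE := pentagonalSeries_eq_dissection ℤ
  have hac := sect_zero_mul_sect_two_pentagonalSeries
  generalize sect 0 (pentagonalSeries ℤ) = a at *
  generalize sect 2 (pentagonalSeries ℤ) = c at *
  generalize expandFive (pentagonalSeries ℤ) = d at *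
  have h1 : X ^ 4 * pentagonalSeries ℤ = expandFive a * X ^ 4 + expandFive (-d) * X ^ 5
      + expandFive c * X ^ 6 := by
    rw [hE, map_neg]; ring
  have h2 : X ^ 3 * pentagonalSeries ℤ ^ 2 = expandFive (a ^ 2) * X ^ 3
      + expandFive (-2 * a * d) * X ^ 4 + expandFive (2 * (a * c) + d ^ 2) * X ^ 5
      + expandFive (-2 * d * c) * X ^ 6 + expandFive (c ^ 2) * X ^ 7 := by
    rw [hE]
    simp only [map_add, map_mul, map_pow, map_neg, map_ofNat]
    ring
  have h3 : X ^ 2 * pentagonalSeries ℤ ^ 3 = expandFive (a ^ 3) * X ^ 2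
      + expandFive (-3 * a ^ 2 * d) * X ^ 3
      + expandFive (3 * a ^ 2 * c + 3 * a * d ^ 2) * X ^ 4
      + expandFive (- d ^ 3 - 6 * d * (a * c)) * X ^ 5
      + expandFive (3 * a * c ^ 2 + 3 * d ^ 2 * c) * X ^ 6
      + expandFive (-3 * d * c ^ 2) * X ^ 7 + expandFive (c ^ 3) * X ^ 8 := by
    rw [hE]
    simp only [map_add, map_sub, map_mul, map_pow, map_neg, map_ofNat]
    ring
  have h4 : X * pentagonalSeries ℤ ^ 4 = expandFive (a ^ 4) * X ^ 1
      + expandFive (-4 * a ^ 3 * d) * X ^ 2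
      + expandFive (4 * a ^ 3 * c + 6 * a ^ 2 * d ^ 2) * X ^ 3
      + expandFive (-12 * a ^ 2 * d * c - 4 * a * d ^ 3) * X ^ 4
      + expandFive (6 * (a * c) ^ 2 + 12 * (a * c) * d ^ 2 + d ^ 4) * X ^ 5
      + expandFive (-12 * a * d * c ^ 2 - 4 * d ^ 3 * c) * X ^ 6
      + expandFive (4 * a * c ^ 3 + 6 * d ^ 2 * c ^ 2) * X ^ 7
      + expandFive (-4 * d * c ^ 3) * X ^ 8 + expandFive (c ^ 4) * X ^ 9 := by
    rw [hE]
    simp only [map_add, map_sub, map_mul, map_pow, map_neg, map_ofNat]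
    ring
  refine ⟨?_, ?_, ?_, ?_⟩
  · rw [h4]
    simp only [LinearMap.map_add, sect_expandFive_mul_X_pow (show 0 < 5 by norm_num),
      Nat.reduceMod, Nat.reduceDiv, Nat.reduceEqDiff, if_true, if_false, one_ne_zero]
    rw [hac]; ring
  · rw [h3]
    simp only [LinearMap.map_add, sect_expandFive_mul_X_pow (show 0 < 5 by norm_num),
      Nat.reduceMod, Nat.reduceDiv, Nat.reduceEqDiff, if_true, if_false, one_ne_zero]
    rw [hac]; ring
  · rw [h2]
    simp only [LinearMap.map_add, sect_expandFive_mul_X_pow (show 0 < 5 by norm_num),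
      Nat.reduceMod, Nat.reduceDiv, Nat.reduceEqDiff, if_true, if_false, one_ne_zero]
    rw [hac]; ring
  · rw [h1]
    simp only [LinearMap.map_add, sect_expandFive_mul_X_pow (show 0 < 5 by norm_num),
      Nat.reduceMod, Nat.reduceDiv, Nat.reduceEqDiff, if_true, if_false, one_ne_zero]
    ring

/-- The factor `f⁴` makes the negative powers `u⁻⁴, …, u⁻¹` available, so that the recurrence starts
from values that can be read off the five-dissection of `f`. -/
theorem sect_zero_mul_uSeries_pow : ∀ i : ℕ,
    sect 0 (X * pentagonalSeries ℤ ^ 4 * uSeries ^ i) =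
      X * expandFive (pentagonalSeries ℤ) ^ 4 * Polynomial.aeval wSeries (sectPoly i)
  | 0 => by
    rw [pow_zero, mul_one, sect_zero_X_pow_mul_pentagonalSeries_pow.1]
    simp only [sectPoly, map_neg, map_ofNat]
    ring
  | 1 => by
    have h : X * pentagonalSeries ℤ ^ 4 * uSeries ^ 1 =
        expandFive (expandFive (pentagonalSeries ℤ)) * (X ^ 2 * pentagonalSeries ℤ ^ 3) := by
      rw [uSeries]
      linear_combination (X ^ 2 * pentagonalSeries ℤ ^ 3 *
        expandFive (expandFive (pentagonalSeries ℤ))) * partitionSeries_mul_pentagonalSeries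
    rw [h, sect_expandFive_mul_of_lt (by norm_num), sect_zero_X_pow_mul_pentagonalSeries_pow.2.1]
    simp only [sectPoly, map_ofNat]
    ring
  | 2 => by
    have hG : (partitionSeries * pentagonalSeries ℤ) ^ 2 = 1 := by
      rw [partitionSeries_mul_pentagonalSeries, one_pow]
    have h : X * pentagonalSeries ℤ ^ 4 * uSeries ^ 2 =
        expandFive (expandFive (pentagonalSeries ℤ) ^ 2) * (X ^ 3 * pentagonalSeries ℤ ^ 2) := by
      rw [uSeries, map_pow]
      linear_combination (X ^ 3 * pentagonalSeries ℤ ^ 2 *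
        expandFive (expandFive (pentagonalSeries ℤ)) ^ 2) * hG
    rw [h, sect_expandFive_mul_of_lt (by norm_num), sect_zero_X_pow_mul_pentagonalSeries_pow.2.2.1]
    simp only [sectPoly, map_neg, map_one]
    ring
  | 3 => by
    have hG : (partitionSeries * pentagonalSeries ℤ) ^ 3 = 1 := by
      rw [partitionSeries_mul_pentagonalSeries, one_pow]
    have h : X * pentagonalSeries ℤ ^ 4 * uSeries ^ 3 =
        expandFive (expandFive (pentagonalSeries ℤ) ^ 3) * (X ^ 4 * pentagonalSeries ℤ) := by
      rw [uSeries, map_pow]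
      linear_combination (X ^ 4 * pentagonalSeries ℤ *
        expandFive (expandFive (pentagonalSeries ℤ)) ^ 3) * hG
    rw [h, sect_expandFive_mul_of_lt (by norm_num), sect_zero_X_pow_mul_pentagonalSeries_pow.2.2.2]
    simp only [sectPoly, map_neg, map_one]
    ring
  | 4 => by
    have hG : (partitionSeries * pentagonalSeries ℤ) ^ 4 = 1 := by
      rw [partitionSeries_mul_pentagonalSeries, one_pow]
    have h : X * pentagonalSeries ℤ ^ 4 * uSeries ^ 4 =
        expandFive (expandFive (pentagonalSeries ℤ) ^ 4) * X ^ 5 := by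
      rw [uSeries, map_pow]
      linear_combination (X ^ 5 * expandFive (expandFive (pentagonalSeries ℤ)) ^ 4) * hG
    rw [h, sect_expandFive_mul_X_pow (by norm_num)]
    simp only [sectPoly, map_one]
    norm_num
    ring
  | i + 5 => by
    have h : X * pentagonalSeries ℤ ^ 4 * uSeries ^ (i + 5) =
        expandFive (25 * wSeries) * (X * pentagonalSeries ℤ ^ 4 * uSeries ^ (i + 4))
        + expandFive (25 * wSeries) * (X * pentagonalSeries ℤ ^ 4 * uSeries ^ (i + 3))
        + expandFive (15 * wSeries) * (X * pentagonalSeries ℤ ^ 4 * uSeries ^ (i + 2))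
        + expandFive (5 * wSeries) * (X * pentagonalSeries ℤ ^ 4 * uSeries ^ (i + 1))
        + expandFive wSeries * (X * pentagonalSeries ℤ ^ 4 * uSeries ^ i) := by
      simp only [map_mul, map_ofNat]
      linear_combination (X * pentagonalSeries ℤ ^ 4 * uSeries ^ i) * uSeries_pow_five
    rw [h]
    simp only [LinearMap.map_add, sect_expandFive_mul_of_lt (show 0 < 5 by norm_num),
      sect_zero_mul_uSeries_pow (i + 4), sect_zero_mul_uSeries_pow (i + 3),
      sect_zero_mul_uSeries_pow (i + 2), sect_zero_mul_uSeries_pow (i + 1),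
      sect_zero_mul_uSeries_pow i]
    rw [sectPoly]
    simp only [map_mul, map_add, map_ofNat, Polynomial.aeval_X]
    ring

theorem expandFive_pentagonalSeries_ne_zero : expandFive (pentagonalSeries ℤ) ≠ 0 := by
  intro h
  have := expandFive_partitionSeries_mul
  rw [h, mul_zero] at this
  exact zero_ne_one this

theorem wSeries_ne_zero : wSeries ≠ 0 := by
  have hG : partitionSeries ≠ 0 := by
    intro h
    have := partitionSeries_mul_pentagonalSeries
    rw [h, zero_mul] at this
    exact zero_ne_one this
  exact mul_ne_zero (mul_ne_zero X_ne_zero (pow_ne_zero _ expandFive_pentagonalSeries_ne_zero))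
    (pow_ne_zero _ hG)

/-- The zeroth section of every power of `u` is a polynomial in `w`. -/
theorem sect_zero_uSeries_pow (i : ℕ) :
    sect 0 (uSeries ^ i) = Polynomial.aeval wSeries (sectPoly (i + 4)) := by
  have h := sect_zero_mul_uSeries_pow (i + 4)
  have hG : (partitionSeries * pentagonalSeries ℤ) ^ 4 = 1 := by
    rw [partitionSeries_mul_pentagonalSeries, one_pow]
  have h' : X * pentagonalSeries ℤ ^ 4 * uSeries ^ (i + 4) =
      expandFive (X * expandFive (pentagonalSeries ℤ) ^ 4) * uSeries ^ i := by
    rw [pow_add, map_mul, map_pow, expand_X]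
    conv_lhs => rw [mul_left_comm, show uSeries ^ 4 =
      (X * expandFive (expandFive (pentagonalSeries ℤ)) * partitionSeries) ^ 4 from rfl]
    linear_combination (X ^ 5 * expandFive (expandFive (pentagonalSeries ℤ)) ^ 4 * uSeries ^ i) * hG
  rw [h', sect_expandFive_mul_of_lt (by norm_num)] at h
  exact mul_left_cancel₀ (mul_ne_zero X_ne_zero
    (pow_ne_zero _ expandFive_pentagonalSeries_ne_zero)) h

/-- The polynomial `Mᵢ` has no terms `wʲ` with `5j < i - 4`, as `u` has order `1` and `w(X⁵)` has
order `5`. -/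
theorem coeff_sectPoly_eq_zero : ∀ i j : ℕ, 5 * j + 4 < i → (sectPoly i).coeff j = 0
  | 0, _, h | 1, _, h | 2, _, h | 3, _, h | 4, _, h => by omega
  | i + 5, 0, _ => by rw [sectPoly, Polynomial.coeff_X_mul_zero]
  | i + 5, j + 1, h => by
    rw [sectPoly, Polynomial.coeff_X_mul]
    simp only [Polynomial.coeff_add, Polynomial.coeff_ofNat_mul,
      coeff_sectPoly_eq_zero (i + 4) j (by omega), coeff_sectPoly_eq_zero (i + 3) j (by omega),
      coeff_sectPoly_eq_zero (i + 2) j (by omega), coeff_sectPoly_eq_zero (i + 1) j (by omega),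
      coeff_sectPoly_eq_zero i j (by omega)]
    norm_num

/-- The 5-adic valuation of the coefficient of `wʲ` in `Mᵢ` is at least `⌊(5j + 3 - i) / 2⌋`. -/
theorem five_pow_dvd_coeff_sectPoly : ∀ i j : ℕ,
    (5 : ℤ) ^ ((5 * j + 3 - i) / 2) ∣ (sectPoly i).coeff j := by
  have key : ∀ (p : Polynomial ℤ) (i j : ℕ), (∀ j, p.coeff (j + 1) = 0) →
      (5 : ℤ) ^ ((3 - i) / 2) ∣ p.coeff 0 → (5 : ℤ) ^ ((5 * j + 3 - i) / 2) ∣ p.coeff j := by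
    intro p i j h h0
    cases j with
    | zero => simpa using h0
    | succ j => rw [h]; exact dvd_zero _
  intro i
  induction i using Nat.strong_induction_on with
  | _ i ih =>
  intro j
  match i with
  | 0 | 1 =>
    exact key _ _ _ (fun j => by simp [sectPoly, Polynomial.coeff_ofNat_succ]) (by simp [sectPoly])
  | 2 | 3 | 4 =>
    exact key _ _ _ (fun j => by simp [sectPoly, Polynomial.coeff_one]) (by simp [sectPoly])
  | i + 5 =>
    cases j with
    | zero => rw [sectPoly, Polynomial.coeff_X_mul_zero]; exact dvd_zero _
    | succ j =>
      rw [sectPoly, Polynomial.coeff_X_mul]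
      simp only [Polynomial.coeff_add, Polynomial.coeff_ofNat_mul]
      -- The coefficient of `M_{i + l}` in the recurrence needs valuation at least `l / 2`.
      have step : ∀ (e l : ℕ) (m : ℤ), l < 5 → (5 : ℤ) ^ e ∣ m → l ≤ 2 * e →
          (5 : ℤ) ^ ((5 * (j + 1) + 3 - (i + 5)) / 2) ∣ m * (sectPoly (i + l)).coeff j := by
        intro e l m hl hm hel
        refine (pow_dvd_pow 5 ?_).trans
          ((pow_add (5 : ℤ) e _).symm ▸ mul_dvd_mul hm (ih (i + l) (by omega) j))
        omega
      have h0 := step 0 0 1 (by norm_num) (by norm_num) (by norm_num)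
      rw [one_mul] at h0
      exact dvd_add (dvd_add (dvd_add (dvd_add
        (step 2 4 25 (by norm_num) (by norm_num) (by norm_num))
        (step 2 3 25 (by norm_num) (by norm_num) (by norm_num)))
        (step 1 2 15 (by norm_num) (by norm_num) (by norm_num)))
        (step 1 1 5 (by norm_num) (by norm_num) (by norm_num))) h0
end Recurrence

/-! ### The five-adic iteration -/

section Divisibility

/-- The integer combinations of the powers `w, w², …` in which the coefficient of `w ^ (j + 1)` is
divisible by `5 ^ (k + ⌊5j / 2⌋)`. -/
noncomputable def divSpan (k : ℕ) : Submodule ℤ ℤ⟦X⟧ :=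
  Submodule.span ℤ (Set.range fun j : ℕ => (5 : ℤ) ^ (k + 5 * j / 2) • wSeries ^ (j + 1))

theorem smul_pow_mem_divSpan {k : ℕ} {m : ℤ} (j : ℕ) (h : (5 : ℤ) ^ (k + 5 * j / 2) ∣ m) :
    m • wSeries ^ (j + 1) ∈ divSpan k := by
  obtain ⟨c, rfl⟩ := h
  rw [mul_comm, mul_smul]
  exact Submodule.smul_mem _ _ (Submodule.subset_span ⟨j, rfl⟩)

theorem exists_eq_smul_of_mem_divSpan {k : ℕ} {f : ℤ⟦X⟧} (hf : f ∈ divSpan k) :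
    ∃ g : ℤ⟦X⟧, f = (5 : ℤ) ^ k • g := by
  induction hf using Submodule.span_induction with
  | mem x hx =>
    obtain ⟨j, rfl⟩ := hx
    exact ⟨(5 : ℤ) ^ (5 * j / 2) • wSeries ^ (j + 1), by
      dsimp only
      rw [pow_add (5 : ℤ), mul_smul]⟩
  | zero => exact ⟨0, by simp⟩
  | add x y _ _ hx hy =>
    obtain ⟨a, rfl⟩ := hx
    obtain ⟨b, rfl⟩ := hy
    exact ⟨a + b, by rw [smul_add]⟩
  | smul c x _ hx =>
    obtain ⟨a, rfl⟩ := hx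
    exact ⟨c • a, by rw [smul_comm]⟩

/-- The zeroth section of `uʳ w ^ (i + 1)` is the polynomial `M / w ^ (i + 1)` in `w`, where `M` is
the polynomial of the zeroth section of `u ^ (6 (i + 1) + r)`. -/
theorem sect_zero_uSeries_pow_mul_wSeries_pow (r i : ℕ) : ∃ p : Polynomial ℤ,
    (∀ j, p.coeff j = (sectPoly (6 * (i + 1) + r + 4)).coeff (j + (i + 2))) ∧
    sect 0 (uSeries ^ r * wSeries ^ (i + 1)) =
      p.sum fun j m => m • wSeries ^ (j + 1) := by
  obtain ⟨p, hp⟩ : Polynomial.X ^ (i + 2) ∣ sectPoly (6 * (i + 1) + r + 4) :=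
    Polynomial.X_pow_dvd_iff.2 fun j hj => coeff_sectPoly_eq_zero _ _ (by omega)
  refine ⟨p, fun j => by rw [hp, Polynomial.coeff_X_pow_mul], ?_⟩
  refine mul_left_cancel₀ (pow_ne_zero (i + 1) wSeries_ne_zero) ?_
  rw [← sect_expandFive_mul_of_lt (by norm_num)]
  have h : expandFive (wSeries ^ (i + 1)) * (uSeries ^ r * wSeries ^ (i + 1)) =
      uSeries ^ (6 * (i + 1) + r) := by
    rw [map_pow, pow_add uSeries, pow_mul uSeries, ← expandFive_wSeries_mul]
    ring
  rw [h, sect_zero_uSeries_pow, hp, map_mul, map_pow, Polynomial.aeval_X,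
    Polynomial.aeval_eq_sum_range, Polynomial.sum_over_range p (by simp), Finset.mul_sum,
    Finset.mul_sum]
  refine Finset.sum_congr rfl fun j _ => ?_
  simp only [Algebra.smul_def, eq_intCast]
  ring

/-- The operator `g ↦ U (uʳ g)` maps `divSpan k` to `divSpan l`, under the inequality between the
valuations of the coefficients that this amounts to. Truncated subtraction is harmless here: it only
replaces negative lower bounds for a valuation by zero. -/
theorem sect_zero_uSeries_pow_mul_mem_divSpan {r k l : ℕ}
    (h : ∀ i j : ℕ, l + 5 * j / 2 ≤ k + 5 * i / 2 + (5 * j + 3 - i - r) / 2)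
    {f : ℤ⟦X⟧} (hf : f ∈ divSpan k) : sect 0 (uSeries ^ r * f) ∈ divSpan l := by
  induction hf using Submodule.span_induction with
  | mem x hx =>
    obtain ⟨i, rfl⟩ := hx
    obtain ⟨p, hp, hs⟩ := sect_zero_uSeries_pow_mul_wSeries_pow r i
    dsimp only
    rw [mul_smul_comm, map_smul, hs, Polynomial.sum, Finset.smul_sum]
    refine Submodule.sum_mem _ fun j _ => ?_
    rw [smul_smul]
    refine smul_pow_mem_divSpan j ?_
    rw [hp]
    refine (pow_dvd_pow 5 (h i j)).trans ?_
    rw [pow_add]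
    refine mul_dvd_mul_left _ ((pow_dvd_pow 5 ?_).trans (five_pow_dvd_coeff_sectPoly _ _))
    omega
  | zero => simp
  | add x y _ _ hx hy =>
    rw [mul_add, map_add]
    exact Submodule.add_mem _ hx hy
  | smul c x _ hx =>
    rw [mul_smul_comm, map_smul]
    exact Submodule.smul_mem _ _ hx

/-- The series `∑ p₋₂(m) Xⁿ` over the progressions `12 m = 12 · 25 ^ a n - 25 ^ a + 1`, with
coefficient zero where `m` is negative. -/
noncomputable def evenSeries : ℕ → ℤ⟦X⟧
  | 0 => partitionSeries ^ 2
  | a + 1 => sect 0 (sect 0 (X ^ 2 * evenSeries a))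

/-- The series `∑ p₋₂(m) Xⁿ` over the progressions
`12 m = 12 · 5 ^ (2 a + 1) n - 5 ^ (2 a + 2) + 1`, with coefficient zero where `m` is negative. -/
noncomputable def oddSeries (a : ℕ) : ℤ⟦X⟧ := sect 0 (X ^ 2 * evenSeries a)

theorem uSeries_sq_mul (f : ℤ⟦X⟧) : uSeries ^ 2 * (pentagonalSeries ℤ ^ 2 * f) =
    expandFive (expandFive (pentagonalSeries ℤ) ^ 2) * (X ^ 2 * f) := by
  have hG : (partitionSeries * pentagonalSeries ℤ) ^ 2 = 1 := by
    rw [partitionSeries_mul_pentagonalSeries, one_pow]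
  rw [uSeries, map_pow]
  linear_combination (X ^ 2 * expandFive (expandFive (pentagonalSeries ℤ)) ^ 2 * f) * hG

theorem sect_zero_uSeries_sq : sect 0 (uSeries ^ 2) =
    (10 : ℤ) • wSeries ^ (0 + 1) + (125 : ℤ) • wSeries ^ (1 + 1) := by
  rw [sect_zero_uSeries_pow]
  simp only [sectPoly, map_add, map_mul, map_neg, map_one, map_ofNat, Polynomial.aeval_X,
    zsmul_eq_mul]
  push_cast
  ring

theorem mul_oddSeries_eq (a : ℕ) : expandFive (pentagonalSeries ℤ) ^ 2 * oddSeries a =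
    sect 0 (uSeries ^ 2 * (pentagonalSeries ℤ ^ 2 * evenSeries a)) := by
  rw [uSeries_sq_mul, sect_expandFive_mul_of_lt (by norm_num), oddSeries]

theorem mul_evenSeries_succ_eq (a : ℕ) : pentagonalSeries ℤ ^ 2 * evenSeries (a + 1) =
    sect 0 (uSeries ^ 0 * (expandFive (pentagonalSeries ℤ) ^ 2 * oddSeries a)) := by
  rw [pow_zero, one_mul, ← map_pow, sect_expandFive_mul_of_lt (by norm_num), oddSeries, evenSeries]

theorem mul_evenSeries_mem_divSpan {a : ℕ}
    (h : expandFive (pentagonalSeries ℤ) ^ 2 * oddSeries a ∈ divSpan (a + 1)) :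
    pentagonalSeries ℤ ^ 2 * evenSeries (a + 1) ∈ divSpan (a + 2) := by
  rw [mul_evenSeries_succ_eq]
  exact sect_zero_uSeries_pow_mul_mem_divSpan (fun i j => by omega) h

theorem mul_oddSeries_mem_divSpan (a : ℕ) :
    expandFive (pentagonalSeries ℤ) ^ 2 * oddSeries a ∈ divSpan (a + 1) := by
  induction a with
  | zero =>
    have h : (partitionSeries * pentagonalSeries ℤ) ^ 2 = 1 := by
      rw [partitionSeries_mul_pentagonalSeries, one_pow]
    rw [mul_oddSeries_eq, evenSeries, ← mul_pow, mul_comm (pentagonalSeries ℤ), h, mul_one,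
      sect_zero_uSeries_sq]
    exact Submodule.add_mem _ (smul_pow_mem_divSpan 0 (by norm_num))
      (smul_pow_mem_divSpan 1 (by norm_num))
  | succ a ih =>
    rw [mul_oddSeries_eq]
    exact sect_zero_uSeries_pow_mul_mem_divSpan (fun i j => by omega)
      (mul_evenSeries_mem_divSpan ih)

theorem five_pow_dvd_coeff_of_mul_mem_divSpan {k : ℕ} {f g h : ℤ⟦X⟧} (hg : g * h = 1)
    (hf : h ^ 2 * f ∈ divSpan k) (n : ℕ) : (5 : ℤ) ^ k ∣ coeff n f := by
  obtain ⟨s, hs⟩ := exists_eq_smul_of_mem_divSpan hf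
  have : f = (5 : ℤ) ^ k • (g ^ 2 * s) := by
    rw [← mul_smul_comm, ← hs, ← mul_assoc, ← mul_pow, hg, one_pow, one_mul]
  rw [this, map_smul, smul_eq_mul]
  exact dvd_mul_right _ _

theorem coeff_oddSeries {a n m : ℕ} (heven : ∀ n m, 12 * m = 12 * 5 ^ (2 * a) * n +
      11 * 5 ^ (2 * a) + 1 → coeff (n + 1) (evenSeries a) = coloredPartitionCount 2 m)
    (h : 12 * m = 12 * 5 ^ (2 * a + 1) * n + 7 * 5 ^ (2 * a + 1) + 1) :
    coeff (n + 1) (oddSeries a) = coloredPartitionCount 2 m := by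
  rw [oddSeries, coeff_sect, show 5 * (n + 1) + 0 = 5 * n + 2 + 1 + 2 by ring, coeff_X_pow_mul]
  exact heven _ _ (by rw [h]; ring)

theorem coeff_evenSeries (a n m : ℕ) (h : 12 * m = 12 * 5 ^ (2 * a) * n + 11 * 5 ^ (2 * a) + 1) :
    coeff (n + 1) (evenSeries a) = coloredPartitionCount 2 m := by
  induction a generalizing n m with
  | zero =>
    obtain rfl : m = n + 1 := by rw [mul_zero, pow_zero] at h; omega
    rw [evenSeries, coloredPartitionCount_two]
  | succ a ih =>
    rw [evenSeries, coeff_sect, show 5 * (n + 1) + 0 = 5 * n + 4 + 1 by ring]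
    exact coeff_oddSeries ih (by rw [h]; ring)

theorem five_pow_dvd_coloredPartitionCount_odd (a n m : ℕ)
    (h : 12 * m = 12 * 5 ^ (2 * a + 1) * n + 7 * 5 ^ (2 * a + 1) + 1) :
    5 ^ (a + 1) ∣ coloredPartitionCount 2 m := by
  have h1 := five_pow_dvd_coeff_of_mul_mem_divSpan expandFive_partitionSeries_mul
    (mul_oddSeries_mem_divSpan a) (n + 1)
  rw [coeff_oddSeries (coeff_evenSeries a) h] at h1
  exact_mod_cast h1

theorem five_pow_dvd_coloredPartitionCount_even (a n m : ℕ)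
    (h : 12 * m = 12 * 5 ^ (2 * a + 2) * n + 11 * 5 ^ (2 * a + 2) + 1) :
    5 ^ (a + 2) ∣ coloredPartitionCount 2 m := by
  have h1 := five_pow_dvd_coeff_of_mul_mem_divSpan partitionSeries_mul_pentagonalSeries
    (mul_evenSeries_mem_divSpan (mul_oddSeries_mem_divSpan a)) (n + 1)
  rw [coeff_evenSeries (a + 1) n m h] at h1
  exact_mod_cast h1

theorem twelve_dvd_offsets (a : ℕ) :
    12 ∣ 7 * 5 ^ (2 * a + 1) + 1 ∧ 12 ∣ 11 * 5 ^ (2 * a + 2) + 1 := by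
  have h : 5 ^ (2 * a) % 12 = 1 := by
    rw [pow_mul, Nat.pow_mod]
    norm_num
  rw [pow_succ, pow_add]
  omega

end Divisibility

theorem theorem1p2 (n α : ℕ) (hα : 1 ≤ α) :
    (12 ∣ 7 * 5 ^ (2 * α - 1) + 1 ∧
      coloredPartitionCount 2 (5 ^ (2 * α - 1) * n + (7 * 5 ^ (2 * α - 1) + 1) / 12)
        ≡ 0 [MOD 5 ^ α]) ∧
    (12 ∣ 11 * 5 ^ (2 * α) + 1 ∧
      coloredPartitionCount 2 (5 ^ (2 * α) * n + (11 * 5 ^ (2 * α) + 1) / 12)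
        ≡ 0 [MOD 5 ^ (α + 1)]) := by
  obtain ⟨a, rfl⟩ := Nat.exists_eq_add_of_le' hα
  rw [show 2 * (a + 1) - 1 = 2 * a + 1 by omega, show 2 * (a + 1) = 2 * a + 2 by ring]
  obtain ⟨h1, h2⟩ := twelve_dvd_offsets a
  refine ⟨⟨h1, Nat.modEq_zero_iff_dvd.2 (five_pow_dvd_coloredPartitionCount_odd a n _ ?_)⟩,
    ⟨h2, Nat.modEq_zero_iff_dvd.2 (five_pow_dvd_coloredPartitionCount_even a n _ ?_)⟩⟩
  · rw [mul_add, Nat.mul_div_cancel' h1]; ring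
  · rw [mul_add, Nat.mul_div_cancel' h2]; ring
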